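/- Let $\phi(\zeta)=2\sinh(\log(\log(1+e^{\zeta})))$ (principal logarithms) and, for $d>0$, let $\mathscr D_d=\{\zeta\in\mathbb C:|\operatorname{Im}\zeta|<d\}$, $\mathscr D_d^{+}=\{\zeta\in\mathscr D_d:\operatorname{Re}\zeta\ge 0\}$ and $\mathscr D_d^{-}=\{\zeta\in\mathscr D_d:\operatorname{Re}\zeta<0\}$. Let $0<d<\pi$, let $f$ be analytic in $\phi(\mathscr D_d)$, and suppose that there are positive constants $K,\alpha,\beta$ such that $$|f(z)|\le K\,|e^{-z}|^{\beta}\quad\text{for all } z\in\phi(\mathscr D_d^{+}),\qquad |f(z)|\le K\,\frac{1}{|z|^{\alpha+1}}\quad\text{for all } z\in\phi(\mathscr D_d^{-}).$$ Let $n$ be a positive integer, $\mu=\min\{\alpha,\beta\}$, $h=\sqrt{2\pi d/(\mu n)}$, and $$\begin{cases} M=n,\quad N=\lceil \alpha n/\beta\rceil & \text{if }\mu=\alpha,\\ N=n,\quad M=\lceil \beta n/\alpha\rceil & \text{if }\mu=\beta.\end{cases}$$ Then $f$ is integrable over $\mathbb R$ and $$\left|\int_{-\infty}^{\infty}f(x)\,dx-h\sum_{k=-M}^{N}f(\phi(kh))\,\phi'(kh)\right|\le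 K\left(\frac{2C_3}{1-e^{-\sqrt{2\pi d\mu}}}+C_4\right)e^{-\sqrt{2\pi d\mu n}},$$ where, with $c_d=1/\cos(d/2)$ and $\lambda=1/\log 2$, $$C_3=\left(\frac1{\alpha+1}+\frac1\alpha\right)\left\{\frac{e\,c_d}{(1-\log 2)(e-1)}\right\}^{\alpha+1}\frac{1+\{\log(2+c_d)\}^2}{\{\log(2+c_d)\}^2}(1+c_d)^2+\frac{(1+\lambda^2)c_d}{\beta}\left(e^{\lambda}c_d\right)^{\beta},$$ $$C_4=\frac{e^{1/\pi^3}}{\alpha(1-\log 2)^{\alpha+1}}+\frac{1+\lambda^2}{\beta}\left(e^{\lambda}\right)^{\beta}.$$ -/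

import Mathlib

namespace SincQuadrature

noncomputable section

/-- The map `φ(ζ) = 2 sinh (log (log (1 + e^ζ)))`, with principal logarithms. -/
def phi (ζ : ℂ) : ℂ :=
  2 * Complex.sinh (Complex.log (Complex.log (1 + Complex.exp ζ)))

/-- The strip `|Im ζ| < d`. -/
def strip (d : ℝ) : Set ℂ := {ζ : ℂ | |ζ.im| < d}

/-- The part `Re ζ < 0` of the strip. -/
def stripNeg (d : ℝ) : Set ℂ := {ζ : ℂ | ζ ∈ strip d ∧ ζ.re < 0}

/-- The part `Re ζ ≥ 0` of the strip. -/
def stripPos (d : ℝ) : Set ℂ := {ζ : ℂ | ζ ∈ strip d ∧ 0 ≤ ζ.re}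

/-- The lower truncation number `M`: it is `n` if `min α β = α`, and `⌈β n / α⌉` if
`min α β = β` (the two agree when `α = β`). -/
def truncM (α β : ℝ) (n : ℕ) : ℕ := if α ≤ β then n else ⌈β * n / α⌉₊

/-- The upper truncation number `N`: it is `⌈α n / β⌉` if `min α β = α`, and `n` if
`min α β = β` (the two agree when `α = β`). -/
def truncN (α β : ℝ) (n : ℕ) : ℕ := if α ≤ β then ⌈α * n / β⌉₊ else n

/-- The mesh size `h = √(2πd / (μn))`. -/
def meshSize (d μ : ℝ) (n : ℕ) : ℝ := Real.sqrt (2 * Real.pi * d / (μ * n))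

/-- `c_d = 1 / cos (d / 2)`. -/
def cConst (d : ℝ) : ℝ := 1 / Real.cos (d / 2)

/-- `λ = 1 / log 2`. -/
def lambdaConst : ℝ := 1 / Real.log 2

/-- The constant `C₃`, depending on `α`, `β`, `d` only. -/
def C₃ (α β d : ℝ) : ℝ :=
  (1 / (α + 1) + 1 / α)
      * (Real.exp 1 * cConst d / ((1 - Real.log 2) * (Real.exp 1 - 1))) ^ (α + 1)
      * ((1 + Real.log (2 + cConst d) ^ 2) / Real.log (2 + cConst d) ^ 2)
      * (1 + cConst d) ^ 2
    + (1 + lambdaConst ^ 2) * cConst d / β * (Real.exp lambdaConst * cConst d) ^ β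

/-- The constant `C₄`, depending on `α`, `β` only. -/
def C₄ (α β : ℝ) : ℝ :=
  Real.exp (1 / Real.pi ^ 3) / (α * (1 - Real.log 2) ^ (α + 1))
    + (1 + lambdaConst ^ 2) / β * (Real.exp lambdaConst) ^ β

/-- The truncated trapezoidal sum `h ∑_{k=-M}^{N} f(φ(kh)) φ'(kh)`. -/
def trapezoid (f : ℂ → ℂ) (h : ℝ) (M N : ℕ) : ℂ :=
  (h : ℂ) * ∑ k ∈ Finset.Icc (-(M : ℤ)) (N : ℤ),
    f (phi ((k * h : ℝ) : ℂ)) * deriv phi ((k * h : ℝ) : ℂ)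

end

end SincQuadrature

/-!
Put `L = log (1 + e^ζ)`. In the strip `|Im ζ| < π` one has `φ = L - 1 / L`, and `φ` maps the real
line bijectively onto itself, so that `∫ f = ∫ F` with `F(ζ) = f(φ(ζ)) φ'(ζ)`, a function
holomorphic in the strip of half-width `d`. The error of the truncated trapezoidal sum of `F` has
two parts.

*Discretization* (`norm_integral_sub_tsum_le`). By Poisson summation, the difference between `∫ F`
and `h ∑_{k ∈ ℤ} F(kh)` is the sum of the Fourier transform of `F` over the nonzero multiples of
`1 / h`. If `|F(ζ)| ≤ G(Re ζ)` in the strip, then shifting the line of integration towards the edge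
of the strip bounds the Fourier transform at `ξ` by `e^{-2πd|ξ|} ∫ G`
(`norm_integral_mul_exp_le`), and a geometric series results. The majorant used is `majorant`,
whose integral is exactly `K C₃`.

*Truncation* (`hasSum_exp_tail`). On the real line `F` is bounded by single exponentials on both
half-lines, and the tails of the sum are lower Riemann sums of these.

The majorants rest on estimates of `L`, with `u = 1 + e^ζ` and `c = 1 / cos (d / 2)`:
`|u| ≥ cos (Im ζ / 2) (1 + e^{Re ζ})`; the inequality `log (1 + |e^w - 1|) ≤ |w|`, which for `w = L`
gives `|L| ≥ log 2` in the right half of the strip and for `w = -L` gives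
`|e^ζ / (u L)| ≤ (1 + c) / log (2 + c)`; and, in the left half,
`|L / (1 + L)| ≤ |e (u - 1) / (e u - 1)|` (`norm_mul_norm_exp_sub_le`). The last holds because
`(1 - e^{-w}) / w = ∫₀¹ e^{-rw} dr`, where the integrand stays in a closed quadrant when
`|Im w| ≤ π / 2`, so that passing from `w` to `w + 1`, which inserts the weight `e^{-r} ≤ 1`,
decreases the modulus.
-/

namespace SincQuadrature

/-! ### The logarithm of `1 + e^ζ` in the strip `|Im ζ| < π` -/

/-- The inner function `log (1 + e^ζ)` of `phi`, with the principal logarithm. -/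
noncomputable def logOneAddExp (ζ : ℂ) : ℂ := Complex.log (1 + Complex.exp ζ)

lemma one_add_exp_re (ζ : ℂ) :
    (1 + Complex.exp ζ).re = 1 + Real.exp ζ.re * Real.cos ζ.im := by
  simp [Complex.exp_re]

lemma one_add_exp_im (ζ : ℂ) :
    (1 + Complex.exp ζ).im = Real.exp ζ.re * Real.sin ζ.im := by
  simp [Complex.exp_im]

lemma one_add_exp_im_eq_zero {ζ : ℂ} (hζ : |ζ.im| < Real.pi)
    (h : (1 + Complex.exp ζ).im = 0) : ζ.im = 0 := by
  rw [one_add_exp_im] at h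
  have hs : Real.sin ζ.im = 0 := by
    rcases mul_eq_zero.mp h with h | h
    · exact absurd h (Real.exp_pos _).ne'
    · exact h
  rw [abs_lt] at hζ
  exact (Real.sin_eq_zero_iff_of_lt_of_lt hζ.1 hζ.2).mp hs

lemma one_add_exp_ne_ofReal {ζ : ℂ} (hζ : |ζ.im| < Real.pi) {r : ℝ} (hr : r ≤ 1) :
    1 + Complex.exp ζ ≠ (r : ℂ) := by
  intro h
  have h0 := one_add_exp_im_eq_zero hζ (by rw [h]; simp)
  have h1 := congrArg Complex.re h
  rw [one_add_exp_re, h0] at h1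
  simp only [Real.cos_zero, mul_one, Complex.ofReal_re] at h1
  linarith [Real.exp_pos ζ.re]

lemma one_add_exp_mem_slitPlane {ζ : ℂ} (hζ : |ζ.im| < Real.pi) :
    1 + Complex.exp ζ ∈ Complex.slitPlane := by
  rw [Complex.mem_slitPlane_iff]
  by_cases h : (1 + Complex.exp ζ).im = 0
  · left
    rw [one_add_exp_re, one_add_exp_im_eq_zero hζ h]
    simp only [Real.cos_zero, mul_one]
    linarith [Real.exp_pos ζ.re]
  · exact Or.inr h

lemma one_add_exp_ne_zero {ζ : ℂ} (hζ : |ζ.im| < Real.pi) : 1 + Complex.exp ζ ≠ 0 :=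
  Complex.slitPlane_ne_zero (one_add_exp_mem_slitPlane hζ)

lemma exp_logOneAddExp {ζ : ℂ} (hζ : |ζ.im| < Real.pi) :
    Complex.exp (logOneAddExp ζ) = 1 + Complex.exp ζ :=
  Complex.exp_log (one_add_exp_ne_zero hζ)

lemma logOneAddExp_ne_ofReal {ζ : ℂ} (hζ : |ζ.im| < Real.pi) {r : ℝ} (hr : r ≤ 0) :
    logOneAddExp ζ ≠ (r : ℂ) := by
  intro h
  refine one_add_exp_ne_ofReal hζ (r := Real.exp r) (Real.exp_le_one_iff.mpr hr) ?_
  rw [← exp_logOneAddExp hζ, h, Complex.ofReal_exp]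

lemma logOneAddExp_ne_zero {ζ : ℂ} (hζ : |ζ.im| < Real.pi) : logOneAddExp ζ ≠ 0 := by
  simpa using logOneAddExp_ne_ofReal hζ (r := 0) le_rfl

lemma hasDerivAt_logOneAddExp {ζ : ℂ} (hζ : |ζ.im| < Real.pi) :
    HasDerivAt logOneAddExp (Complex.exp ζ / (1 + Complex.exp ζ)) ζ :=
  ((Complex.hasDerivAt_exp ζ).const_add 1).clog (one_add_exp_mem_slitPlane hζ)

/-- As `2 sinh (log L) = L - 1 / L`, the outer logarithm of `phi` disappears. -/
lemma phi_eq {ζ : ℂ} (hζ : |ζ.im| < Real.pi) :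
    phi ζ = logOneAddExp ζ - (logOneAddExp ζ)⁻¹ := by
  have h : phi ζ = 2 * Complex.sinh (Complex.log (logOneAddExp ζ)) := rfl
  rw [h, Complex.two_sinh, Complex.exp_neg, Complex.exp_log (logOneAddExp_ne_zero hζ)]

lemma isOpen_strip (d : ℝ) : IsOpen (strip d) :=
  isOpen_lt (Complex.continuous_im.abs) continuous_const

lemma hasDerivAt_phi {ζ : ℂ} (hζ : |ζ.im| < Real.pi) :
    HasDerivAt phi
      (Complex.exp ζ / (1 + Complex.exp ζ) * (1 + ((logOneAddExp ζ)⁻¹) ^ 2)) ζ := by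
  have h1 := hasDerivAt_logOneAddExp hζ
  have h2 := h1.sub (h1.inv (logOneAddExp_ne_zero hζ))
  have h3 : phi =ᶠ[nhds ζ] logOneAddExp - logOneAddExp⁻¹ := by
    filter_upwards [(isOpen_strip Real.pi).mem_nhds hζ] with w hw
    exact phi_eq hw
  refine (h2.congr_of_eventuallyEq h3).congr_deriv ?_
  have := logOneAddExp_ne_zero hζ
  have := one_add_exp_ne_zero hζ
  field_simp
  ring

/-! ### Elementary inequalities -/

lemma norm_exp_sub_one_le_exp_norm_sub_one (w : ℂ) :
    ‖Complex.exp w - 1‖ ≤ Real.exp ‖w‖ - 1 := by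
  simpa using Complex.norm_exp_sub_sum_le_exp_norm_sub_sum w 1

lemma log_one_add_norm_exp_sub_one_le (w : ℂ) : Real.log (1 + ‖Complex.exp w - 1‖) ≤ ‖w‖ := by
  rw [Real.log_le_iff_le_exp (by positivity)]
  linarith [norm_exp_sub_one_le_exp_norm_sub_one w]

/-- `r ↦ log (1 + r) / r` is antitone, written without division. This is Bernoulli's inequality. -/
lemma mul_log_one_add_le {a b : ℝ} (ha : 0 ≤ a) (hab : a ≤ b) :
    a * Real.log (1 + b) ≤ b * Real.log (1 + a) := by
  rcases ha.eq_or_lt with rfl | ha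
  · simp
  have h := one_add_mul_self_le_rpow_one_add (s := a) (by linarith) (p := b / a)
    ((one_le_div ha).mpr hab)
  rw [div_mul_cancel₀ _ ha.ne'] at h
  have h2 := Real.log_le_log (by linarith) h
  rw [Real.log_rpow (by linarith)] at h2
  calc a * Real.log (1 + b) ≤ a * (b / a * Real.log (1 + a)) := by gcongr
    _ = b * Real.log (1 + a) := by field_simp

/-- Inside the strip, `1 + e^ζ` is bounded below by its value at the real point `Re ζ`, up to the
factor `cos (Im ζ / 2)`. -/
lemma cos_mul_one_add_exp_le_norm (ζ : ℂ) :
    Real.cos (ζ.im / 2) * (1 + Real.exp ζ.re) ≤ ‖1 + Complex.exp ζ‖ := by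
  refine le_of_sq_le_sq ?_ (norm_nonneg _)
  rw [← Complex.normSq_eq_norm_sq, Complex.normSq_apply, one_add_exp_re, one_add_exp_im]
  have hc : Real.cos ζ.im = 2 * Real.cos (ζ.im / 2) ^ 2 - 1 := by
    rw [← Real.cos_two_mul]; ring_nf
  have hs := Real.sin_sq_add_cos_sq ζ.im
  have h1 := Real.cos_sq_le_one (ζ.im / 2)
  set C := Real.cos (ζ.im / 2)
  set E := Real.exp ζ.re
  have : (1 + E * Real.cos ζ.im) * (1 + E * Real.cos ζ.im) + E * Real.sin ζ.im * (E * Real.sin ζ.im)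
      = 1 + 2 * E * Real.cos ζ.im + E ^ 2 := by
    linear_combination E ^ 2 * hs
  rw [this, hc]
  nlinarith [mul_nonneg (sub_nonneg.mpr h1) (sq_nonneg (E - 1))]

lemma norm_exp_div_le {ζ : ℂ} {c : ℝ} (hc : 1 ≤ c * Real.cos (ζ.im / 2)) (hc0 : 0 ≤ c) :
    ‖Complex.exp ζ / (1 + Complex.exp ζ)‖ ≤ c * (Real.exp ζ.re / (1 + Real.exp ζ.re)) := by
  have hE := Real.exp_pos ζ.re
  have h := mul_le_mul_of_nonneg_left (cos_mul_one_add_exp_le_norm ζ) hc0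
  have h' : 1 + Real.exp ζ.re ≤ c * ‖1 + Complex.exp ζ‖ := by nlinarith
  have hpos : 0 < ‖1 + Complex.exp ζ‖ := by
    by_contra! h0
    nlinarith [norm_nonneg (1 + Complex.exp ζ)]
  rw [norm_div, Complex.norm_exp, ← mul_div_assoc, div_le_div_iff₀ hpos (by linarith)]
  nlinarith

lemma norm_exp_div_le_const {ζ : ℂ} {c : ℝ} (hc : 1 ≤ c * Real.cos (ζ.im / 2)) (hc0 : 0 ≤ c) :
    ‖Complex.exp ζ / (1 + Complex.exp ζ)‖ ≤ c := by
  refine (norm_exp_div_le hc hc0).trans (mul_le_of_le_one_right hc0 ?_)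
  have := Real.exp_pos ζ.re
  rw [div_le_one (by linarith)]
  linarith

/-! ### Estimates in the right half of the strip -/

lemma norm_inv_logOneAddExp_le {ζ : ℂ} (hζ : |ζ.im| < Real.pi) (hre : 0 ≤ ζ.re) :
    ‖(logOneAddExp ζ)⁻¹‖ ≤ lambdaConst := by
  have h := log_one_add_norm_exp_sub_one_le (logOneAddExp ζ)
  rw [exp_logOneAddExp hζ, add_sub_cancel_left, Complex.norm_exp] at h
  have h2 : Real.log 2 ≤ ‖logOneAddExp ζ‖ := by
    refine le_trans (Real.log_le_log (by norm_num) ?_) h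
    linarith [Real.one_le_exp hre]
  rw [norm_inv, lambdaConst, one_div]
  exact inv_anti₀ (Real.log_pos (by norm_num)) h2

lemma norm_exp_neg_phi_le {ζ : ℂ} (hζ : |ζ.im| < Real.pi) (hre : 0 ≤ ζ.re) {c : ℝ}
    (hc : 1 ≤ c * Real.cos (ζ.im / 2)) (hc0 : 0 ≤ c) :
    ‖Complex.exp (-phi ζ)‖ ≤ Real.exp lambdaConst * c * Real.exp (-ζ.re) := by
  have h1 : Complex.exp (-phi ζ)
      = Complex.exp (logOneAddExp ζ)⁻¹ * (Complex.exp ζ / (1 + Complex.exp ζ))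
        * Complex.exp (-ζ) := by
    rw [phi_eq hζ, neg_sub, Complex.exp_sub, exp_logOneAddExp hζ, Complex.exp_neg ζ]
    have := Complex.exp_ne_zero ζ
    field_simp
  rw [h1, norm_mul, norm_mul, Complex.norm_exp (-ζ), Complex.neg_re]
  have h2 : ‖Complex.exp (logOneAddExp ζ)⁻¹‖ ≤ Real.exp lambdaConst := by
    rw [Complex.norm_exp]
    exact Real.exp_le_exp.mpr ((Complex.re_le_norm _).trans (norm_inv_logOneAddExp_le hζ hre))
  have h3 := norm_exp_div_le_const hc hc0
  gcongr

lemma norm_deriv_phi_le_right {ζ : ℂ} (hζ : |ζ.im| < Real.pi) (hre : 0 ≤ ζ.re) {c : ℝ}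
    (hc : 1 ≤ c * Real.cos (ζ.im / 2)) (hc0 : 0 ≤ c) :
    ‖deriv phi ζ‖ ≤ (1 + lambdaConst ^ 2) * c := by
  rw [(hasDerivAt_phi hζ).deriv, norm_mul, mul_comm]
  have h3 := norm_exp_div_le_const hc hc0
  have h4 := norm_inv_logOneAddExp_le hζ hre
  have h5 : ‖1 + ((logOneAddExp ζ)⁻¹) ^ 2‖ ≤ 1 + lambdaConst ^ 2 := by
    refine (norm_add_le _ _).trans ?_
    rw [norm_one, norm_pow]
    gcongr
  gcongr

/-! ### Estimates in the left half of the strip -/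

lemma abs_integral_exp_neg_mul_le_of_nonneg {g : ℝ → ℝ} (hg : Continuous g)
    (h : ∀ r ∈ Set.Icc (0:ℝ) 1, 0 ≤ g r) :
    |∫ r in (0:ℝ)..1, Real.exp (-r) * g r| ≤ |∫ r in (0:ℝ)..1, g r| := by
  have h1 : 0 ≤ ∫ r in (0:ℝ)..1, Real.exp (-r) * g r :=
    intervalIntegral.integral_nonneg zero_le_one fun r hr => mul_nonneg (Real.exp_pos _).le (h r hr)
  rw [abs_of_nonneg h1, abs_of_nonneg (intervalIntegral.integral_nonneg zero_le_one h)]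
  refine intervalIntegral.integral_mono_on zero_le_one
    ((by fun_prop : Continuous fun r => Real.exp (-r) * g r).intervalIntegrable _ _)
    (hg.intervalIntegrable _ _) fun r hr => ?_
  exact mul_le_of_le_one_left (h r hr) (Real.exp_le_one_iff.mpr (by linarith [hr.1]))

lemma abs_integral_exp_neg_mul_le {g : ℝ → ℝ} (hg : Continuous g)
    (h : (∀ r ∈ Set.Icc (0:ℝ) 1, 0 ≤ g r) ∨ ∀ r ∈ Set.Icc (0:ℝ) 1, g r ≤ 0) :
    |∫ r in (0:ℝ)..1, Real.exp (-r) * g r| ≤ |∫ r in (0:ℝ)..1, g r| := by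
  rcases h with h | h
  · exact abs_integral_exp_neg_mul_le_of_nonneg hg h
  · have := abs_integral_exp_neg_mul_le_of_nonneg hg.neg fun r hr => neg_nonneg.mpr (h r hr)
    simpa using this

/-- Enlarging a positive weight enlarges the modulus of an integral whose integrand stays in one
closed quadrant; here the weights are `e^{-r} ≤ 1` and the integrand is `e^{-rw}`. -/
lemma norm_integral_exp_neg_mul_le {w : ℂ} (hw : |w.im| ≤ Real.pi / 2) :
    ‖∫ r in (0:ℝ)..1, Complex.exp (-(w + 1) * r)‖ ≤ ‖∫ r in (0:ℝ)..1, Complex.exp (-w * r)‖ := by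
  have hre (v : ℂ) : (∫ r in (0:ℝ)..1, Complex.exp (-v * r)).re
      = ∫ r in (0:ℝ)..1, (Complex.exp (-v * r)).re :=
    (Complex.reCLM.intervalIntegral_comp_comm
      ((by fun_prop : Continuous fun r : ℝ => Complex.exp (-v * r)).intervalIntegrable 0 1)).symm
  have him (v : ℂ) : (∫ r in (0:ℝ)..1, Complex.exp (-v * r)).im
      = ∫ r in (0:ℝ)..1, (Complex.exp (-v * r)).im :=
    (Complex.imCLM.intervalIntegral_comp_comm
      ((by fun_prop : Continuous fun r : ℝ => Complex.exp (-v * r)).intervalIntegrable 0 1)).symm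
  have hsplit (r : ℝ) : Complex.exp (-(w + 1) * r) = (Real.exp (-r) : ℝ) * Complex.exp (-w * r) := by
    rw [Complex.ofReal_exp, ← Complex.exp_add]
    congr 1
    push_cast
    ring
  have hpi := Real.pi_pos
  have hb := abs_le.mp hw
  rw [Complex.norm_def, Complex.norm_def]
  refine Real.sqrt_le_sqrt ?_
  rw [Complex.normSq_apply, Complex.normSq_apply, hre, him, hre, him]
  simp only [hsplit, Complex.re_ofReal_mul, Complex.im_ofReal_mul]
  refine add_le_add ?_ ?_
  · refine abs_le_iff_mul_self_le.mp (abs_integral_exp_neg_mul_le (by fun_prop) (Or.inl ?_))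
    intro r hr
    rw [Complex.exp_re]
    refine mul_nonneg (Real.exp_pos _).le (Real.cos_nonneg_of_mem_Icc ?_)
    simp only [Complex.mul_im, Complex.neg_im, Complex.neg_re, Complex.ofReal_im,
      Complex.ofReal_re, mul_zero, zero_add]
    constructor <;> nlinarith [hr.1, hr.2]
  · refine abs_le_iff_mul_self_le.mp (abs_integral_exp_neg_mul_le (by fun_prop) ?_)
    simp only [Complex.exp_im, Complex.mul_im, Complex.neg_im, Complex.neg_re, Complex.ofReal_im,
      Complex.ofReal_re, mul_zero, zero_add]
    rcases le_total w.im 0 with h | h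
    · refine Or.inl fun r hr => mul_nonneg (Real.exp_pos _).le
        (Real.sin_nonneg_of_nonneg_of_le_pi ?_ ?_) <;> nlinarith [hr.1, hr.2]
    · refine Or.inr fun r hr => mul_nonpos_of_nonneg_of_nonpos (Real.exp_pos _).le
        (Real.sin_nonpos_of_nonpos_of_neg_pi_le ?_ ?_) <;> nlinarith [hr.1, hr.2]

/-- The inequality `|L / (1 + L)| ≤ |e (u - 1) / (e u - 1)|` for `u = e^L` in the right half plane;
it follows from `(1 - e^{-w}) / w = ∫₀¹ e^{-rw} dr` for `w = L` and `w = L + 1`. -/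
lemma norm_mul_norm_exp_sub_le {w : ℂ} (hw : |w.im| ≤ Real.pi / 2) (h0 : w ≠ 0) (h1 : w + 1 ≠ 0) :
    ‖w‖ * ‖Complex.exp 1 * Complex.exp w - 1‖ ≤
      ‖1 + w‖ * (Real.exp 1 * ‖Complex.exp w - 1‖) := by
  have key := norm_integral_exp_neg_mul_le hw
  rw [integral_exp_mul_complex (neg_ne_zero.mpr h0), integral_exp_mul_complex (neg_ne_zero.mpr h1)]
    at key
  simp only [Complex.ofReal_one, Complex.ofReal_zero, mul_one, mul_zero, Complex.exp_zero,
    norm_div, norm_neg] at key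
  rw [div_le_div_iff₀ (norm_pos_iff.mpr h1) (norm_pos_iff.mpr h0)] at key
  have e1 : Complex.exp 1 * Complex.exp w - 1
      = -(Complex.exp (w + 1) * (Complex.exp (-(w + 1)) - 1)) := by
    rw [mul_sub, ← Complex.exp_add (w + 1), add_neg_cancel, Complex.exp_zero, Complex.exp_add]; ring
  have e2 : Complex.exp w - 1 = -(Complex.exp w * (Complex.exp (-w) - 1)) := by
    rw [mul_sub, ← Complex.exp_add, add_neg_cancel, Complex.exp_zero]; ring
  rw [e1, e2, norm_neg, norm_neg, norm_mul, norm_mul, Complex.norm_exp, Complex.norm_exp,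
    Complex.add_re, Complex.one_re, Real.exp_add, add_comm 1 w]
  have hE : 0 ≤ Real.exp w.re * Real.exp 1 := by positivity
  nlinarith [mul_le_mul_of_nonneg_left key hE]

/-- The constant for which `leftConst c * e^{Re ζ}` bounds `1 / |φ(ζ)|` in the left half of the
strip. -/
noncomputable def leftConst (c : ℝ) : ℝ :=
  Real.exp 1 * c / ((1 - Real.log 2) * (Real.exp 1 - 1))

lemma one_sub_log_two_pos : 0 < 1 - Real.log 2 := by
  linarith [Real.log_two_lt_d9]

lemma logOneAddExp_im_re_le {ζ : ℂ} (hζ : |ζ.im| < Real.pi) (hre : ζ.re < 0) :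
    |(logOneAddExp ζ).im| ≤ Real.pi / 2 ∧ (logOneAddExp ζ).re ≤ Real.log 2 := by
  have hE : Real.exp ζ.re < 1 := by simpa using hre
  constructor
  · rw [logOneAddExp, Complex.log_im, Complex.abs_arg_le_pi_div_two_iff, one_add_exp_re]
    nlinarith [Real.neg_one_le_cos ζ.im, Real.exp_pos ζ.re]
  · rw [logOneAddExp, Complex.log_re]
    refine Real.log_le_log (norm_pos_iff.mpr (one_add_exp_ne_zero hζ)) ?_
    refine (norm_add_le _ _).trans ?_
    rw [norm_one, Complex.norm_exp]; linarith

lemma norm_inv_phi_le {ζ : ℂ} (hζ : |ζ.im| < Real.pi) (hre : ζ.re < 0) {c : ℝ}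
    (hc : 1 ≤ c * Real.cos (ζ.im / 2)) (hc0 : 0 ≤ c) :
    ‖phi ζ‖⁻¹ ≤ leftConst c * Real.exp ζ.re := by
  obtain ⟨him, hLre⟩ := logOneAddExp_im_re_le hζ hre
  have hL0 := logOneAddExp_ne_zero hζ
  have hL1 : logOneAddExp ζ + 1 ≠ 0 := fun h =>
    logOneAddExp_ne_ofReal hζ (r := -1) (by norm_num) (by
      rw [eq_neg_of_add_eq_zero_left h]; simp)
  have key := norm_mul_norm_exp_sub_le him hL0 hL1
  rw [exp_logOneAddExp hζ, add_sub_cancel_left, Complex.norm_exp ζ] at key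
  have he : 0 < Real.exp 1 - 1 := by linarith [Real.add_one_lt_exp (one_ne_zero)]
  have he0 := Real.exp_pos 1
  -- `e u - 1 = (e - 1) (1 + e^{ζ + s})` with `s = log (e / (e - 1))`, a
  -- horizontal shift, so the lower bound for `|1 + e^ζ|` applies with the same imaginary part
  have hshift : Real.exp 1 - 1 ≤ c * ‖Complex.exp 1 * (1 + Complex.exp ζ) - 1‖ := by
    have h1 := cos_mul_one_add_exp_le_norm (ζ + (Real.log (Real.exp 1 / (Real.exp 1 - 1)) : ℝ))
    rw [Complex.exp_add, ← Complex.ofReal_exp, Complex.add_im, Complex.ofReal_im, add_zero,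
      Complex.add_re, Complex.ofReal_re, Real.exp_add, Real.exp_log (by positivity)] at h1
    have e2 : Complex.exp 1 * (1 + Complex.exp ζ) - 1 = ((Real.exp 1 - 1 : ℝ) : ℂ) *
        (1 + Complex.exp ζ * ((Real.exp 1 / (Real.exp 1 - 1) : ℝ) : ℂ)) := by
      have : ((Real.exp 1 : ℝ) : ℂ) - 1 ≠ 0 := by exact_mod_cast he.ne'
      rw [show Complex.exp 1 = ((Real.exp 1 : ℝ) : ℂ) by simp]
      push_cast at this ⊢
      field_simp
      ring
    rw [e2, norm_mul, Complex.norm_real, Real.norm_of_nonneg he.le]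
    have h2 : 0 ≤ Real.exp ζ.re * (Real.exp 1 / (Real.exp 1 - 1)) := by positivity
    have h3 : 1 ≤ c * ‖1 + Complex.exp ζ * ((Real.exp 1 / (Real.exp 1 - 1) : ℝ) : ℂ)‖ := by
      nlinarith [mul_le_mul_of_nonneg_left h1 hc0]
    nlinarith
  have hsub : 1 - Real.log 2 ≤ ‖logOneAddExp ζ - 1‖ := by
    refine le_trans ?_ ((Complex.abs_re_le_norm _).trans_eq' rfl)
    rw [Complex.sub_re, Complex.one_re]
    exact le_trans (by linarith) (neg_le_abs _)
  have h12 := one_sub_log_two_pos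
  have hphi : ‖phi ζ‖⁻¹ = ‖logOneAddExp ζ‖ / (‖logOneAddExp ζ - 1‖ * ‖1 + logOneAddExp ζ‖) := by
    rw [phi_eq hζ, ← norm_mul, ← norm_div, ← norm_inv]
    congr 1
    rw [← inv_div]
    congr 1
    field_simp
    ring
  have hp1 : 0 < ‖logOneAddExp ζ - 1‖ := h12.trans_le hsub
  have hp2 : 0 < ‖1 + logOneAddExp ζ‖ := norm_pos_iff.mpr (by rwa [add_comm])
  have h5 : ‖logOneAddExp ζ‖ * (Real.exp 1 - 1) ≤
      c * (‖1 + logOneAddExp ζ‖ * (Real.exp 1 * Real.exp ζ.re)) := by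
    calc _ ≤ ‖logOneAddExp ζ‖ * (c * ‖Complex.exp 1 * (1 + Complex.exp ζ) - 1‖) := by gcongr
      _ = c * (‖logOneAddExp ζ‖ * ‖Complex.exp 1 * (1 + Complex.exp ζ) - 1‖) := by ring
      _ ≤ _ := by gcongr
  rw [hphi, leftConst, div_mul_eq_mul_div, div_le_div_iff₀ (by positivity) (by positivity)]
  calc ‖logOneAddExp ζ‖ * ((1 - Real.log 2) * (Real.exp 1 - 1))
      = (1 - Real.log 2) * (‖logOneAddExp ζ‖ * (Real.exp 1 - 1)) := by ring
    _ ≤ ‖logOneAddExp ζ - 1‖ * (c * (‖1 + logOneAddExp ζ‖ * (Real.exp 1 * Real.exp ζ.re))) := by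
      gcongr
    _ = _ := by ring

lemma norm_exp_div_mul_inv_le {ζ : ℂ} (hζ : |ζ.im| < Real.pi) {c : ℝ}
    (hc : 1 ≤ c * Real.cos (ζ.im / 2)) (hc0 : 0 ≤ c) :
    ‖Complex.exp ζ / (1 + Complex.exp ζ) * (logOneAddExp ζ)⁻¹‖ ≤ (1 + c) / Real.log (2 + c) := by
  have h1 := log_one_add_norm_exp_sub_one_le (-logOneAddExp ζ)
  have e1 : Complex.exp (-logOneAddExp ζ) - 1 = -(Complex.exp ζ / (1 + Complex.exp ζ)) := by
    rw [Complex.exp_neg, exp_logOneAddExp hζ]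
    have := one_add_exp_ne_zero hζ
    field_simp
    ring
  rw [e1, norm_neg, norm_neg] at h1
  have h2 := norm_exp_div_le_const hc hc0
  have h3 := mul_log_one_add_le (norm_nonneg (Complex.exp ζ / (1 + Complex.exp ζ)))
    (show _ ≤ 1 + c by linarith)
  have hL : 0 < ‖logOneAddExp ζ‖ := norm_pos_iff.mpr (logOneAddExp_ne_zero hζ)
  have hl : 0 < Real.log (2 + c) := Real.log_pos (by linarith)
  rw [show 1 + (1 + c) = 2 + c by ring] at h3
  rw [norm_mul, norm_inv, ← div_eq_mul_inv, div_le_div_iff₀ hL hl]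
  exact h3.trans (by gcongr)

lemma norm_deriv_phi_le_left {ζ : ℂ} (hζ : |ζ.im| < Real.pi) {c : ℝ}
    (hc : 1 ≤ c * Real.cos (ζ.im / 2)) (hc0 : 0 ≤ c) :
    ‖deriv phi ζ‖ ≤ (1 + Real.exp (-ζ.re)) *
      ((1 + Real.log (2 + c) ^ 2) / Real.log (2 + c) ^ 2 * (1 + c) ^ 2) := by
  have h1 := norm_exp_div_mul_inv_le hζ hc hc0
  have h2 := norm_exp_div_le_const hc hc0
  have hl : 0 < Real.log (2 + c) := Real.log_pos (by linarith)
  set q := Complex.exp ζ / (1 + Complex.exp ζ) with hq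
  have hd : deriv phi ζ = (1 + Complex.exp (-ζ)) * (q ^ 2 + (q * (logOneAddExp ζ)⁻¹) ^ 2) := by
    have h0 : (1 + Complex.exp (-ζ)) * q = 1 := by
      have := one_add_exp_ne_zero hζ
      have := Complex.exp_ne_zero ζ
      rw [hq, Complex.exp_neg]
      field_simp
      ring
    rw [(hasDerivAt_phi hζ).deriv, ← hq]
    linear_combination (-q - q * (logOneAddExp ζ)⁻¹ ^ 2) * h0
  have h3 : ‖1 + Complex.exp (-ζ)‖ ≤ 1 + Real.exp (-ζ.re) := by
    refine (norm_add_le _ _).trans ?_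
    rw [norm_one, Complex.norm_exp, Complex.neg_re]
  have h4 : ‖q ^ 2 + (q * (logOneAddExp ζ)⁻¹) ^ 2‖ ≤
      (1 + c) ^ 2 + ((1 + c) / Real.log (2 + c)) ^ 2 := by
    refine (norm_add_le _ _).trans ?_
    rw [norm_pow, norm_pow]
    gcongr
    linarith
  rw [hd, norm_mul]
  refine (mul_le_mul h3 h4 (norm_nonneg _) (by positivity)).trans (le_of_eq ?_)
  field_simp
  ring

/-! ### Sums over the integers -/

lemma sum_Icc_neg_eq_add (f : ℤ → ℂ) (M N : ℕ) :
    ∑ k ∈ Finset.Icc (-(M : ℤ)) (N : ℤ), f k =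
      ∑ j ∈ Finset.range (N + 1), f j + ∑ j ∈ Finset.range M, f (-((j : ℤ) + 1)) := by
  induction M with
  | zero =>
    induction N with
    | zero => simp
    | succ N ih =>
      have hI : Finset.Icc (-((0 : ℕ) : ℤ)) ((N + 1 : ℕ) : ℤ)
          = insert ((N + 1 : ℕ) : ℤ) (Finset.Icc (-((0 : ℕ) : ℤ)) (N : ℤ)) := by
        ext k; simp only [Finset.mem_Icc, Finset.mem_insert]; omega
      rw [Finset.sum_range_succ, hI, Finset.sum_insert (by simp), ih]
      ring
  | succ M ih =>
    have hI : Finset.Icc (-((M + 1 : ℕ) : ℤ)) (N : ℤ)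
        = insert (-((M : ℤ) + 1)) (Finset.Icc (-(M : ℤ)) (N : ℤ)) := by
      ext k; simp only [Finset.mem_Icc, Finset.mem_insert]; omega
    rw [Finset.sum_range_succ _ M, hI, Finset.sum_insert (by simp), ih]
    ring

lemma norm_tsum_int_sub_sum_Icc_le {f : ℤ → ℂ} (M N : ℕ) {a b : ℕ → ℝ} {A B : ℝ}
    (ha : HasSum a A) (hb : HasSum b B) (hfa : ∀ j : ℕ, ‖f (N + 1 + j)‖ ≤ a j)
    (hfb : ∀ j : ℕ, ‖f (-(M + 1 + j))‖ ≤ b j) :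
    Summable f ∧ ‖∑' k, f k - ∑ k ∈ Finset.Icc (-(M : ℤ)) (N : ℤ), f k‖ ≤ A + B := by
  have h1 : Summable fun j : ℕ => f (j : ℤ) := by
    rw [← summable_nat_add_iff (N + 1)]
    refine Summable.of_norm_bounded ha.summable fun j => ?_
    have := hfa j
    rwa [show ((N : ℤ) + 1 + j) = ((j + (N + 1) : ℕ) : ℤ) by push_cast; ring] at this
  have h2 : Summable fun j : ℕ => f (-((j : ℤ) + 1)) := by
    rw [← summable_nat_add_iff M]
    refine Summable.of_norm_bounded hb.summable fun j => ?_
    have := hfb j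
    rwa [show (-((M : ℤ) + 1 + j)) = -(((j + M : ℕ) : ℤ) + 1) by push_cast; ring] at this
  have h3 := HasSum.of_nat_of_neg_add_one h1.hasSum h2.hasSum
  refine ⟨h3.summable, ?_⟩
  rw [h3.tsum_eq, sum_Icc_neg_eq_add, ← h1.sum_add_tsum_nat_add (N + 1),
    ← h2.sum_add_tsum_nat_add M, add_add_add_comm, add_sub_cancel_left]
  refine (norm_add_le _ _).trans (add_le_add ?_ ?_)
  · refine tsum_of_norm_bounded ha fun j => ?_
    have := hfa j
    rwa [show ((N : ℤ) + 1 + j) = ((j + (N + 1) : ℕ) : ℤ) by push_cast; ring] at this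
  · refine tsum_of_norm_bounded hb fun j => ?_
    have := hfb j
    rwa [show (-((M : ℤ) + 1 + j)) = -(((j + M : ℕ) : ℤ) + 1) by push_cast; ring] at this

/-! ### Shifting the line of integration -/

lemma mem_strip_add_mul_I {d x y : ℝ} (hy : |y| < d) : (x : ℂ) + y * Complex.I ∈ strip d := by
  simpa [strip] using hy

lemma integrable_ite_neg {a b : ℝ → ℝ} (ha : MeasureTheory.IntegrableOn a (Set.Iic 0))
    (hb : MeasureTheory.IntegrableOn b (Set.Ioi 0)) :
    MeasureTheory.Integrable (fun x => if x < 0 then a x else b x) ∧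
      ∫ x, (if x < 0 then a x else b x) = (∫ x in Set.Iic 0, a x) + ∫ x in Set.Ioi 0, b x := by
  have ha' : MeasureTheory.IntegrableOn a (Set.Iio 0) := ha.mono_set Set.Iio_subset_Iic_self
  have hb' : MeasureTheory.IntegrableOn b (Set.Ici 0) := by
    rwa [integrableOn_Ici_iff_integrableOn_Ioi]
  have e1 : Set.EqOn a (fun x => if x < 0 then a x else b x) (Set.Iio 0) :=
    fun x hx => (if_pos hx).symm
  have e2 : Set.EqOn b (fun x => if x < 0 then a x else b x) (Set.Ici 0) :=
    fun x hx => (if_neg (not_lt.mpr hx)).symm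
  have h1 := ha'.congr_fun e1 measurableSet_Iio
  have h2 := hb'.congr_fun e2 measurableSet_Ici
  constructor
  · rw [← MeasureTheory.integrableOn_univ, ← Set.Iio_union_Ici (a := (0 : ℝ))]
    exact h1.union h2
  · rw [← intervalIntegral.integral_Iio_add_Ici h1 h2,
      ← MeasureTheory.setIntegral_congr_fun measurableSet_Iio e1,
      ← MeasureTheory.setIntegral_congr_fun measurableSet_Ici e2,
      MeasureTheory.integral_Iic_eq_integral_Iio, MeasureTheory.integral_Ici_eq_integral_Ioi]

lemma integrable_exp_neg_mul_abs {γ : ℝ} (hγ : 0 < γ) :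
    MeasureTheory.Integrable fun x : ℝ => Real.exp (-γ * |x|) := by
  refine (integrable_ite_neg (integrableOn_exp_mul_Iic hγ 0)
    (integrableOn_exp_mul_Ioi (neg_lt_zero.mpr hγ) 0)).1.congr (Filter.Eventually.of_forall ?_)
  intro x
  rcases lt_or_ge x 0 with hx | hx
  · simp [hx, abs_of_neg hx]
  · simp [not_lt.mpr hx, abs_of_nonneg hx]

lemma integrable_horizontal {H : ℂ → ℂ} {d B γ : ℝ} (hH : DifferentiableOn ℂ H (strip d))
    (hγ : 0 < γ) (hb : ∀ ζ ∈ strip d, ‖H ζ‖ ≤ B * Real.exp (-γ * |ζ.re|)) {y : ℝ} (hy : |y| < d) :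
    MeasureTheory.Integrable fun x : ℝ => H (x + y * Complex.I) := by
  have hc : Continuous fun x : ℝ => H (x + y * Complex.I) :=
    hH.continuousOn.comp_continuous (by fun_prop) fun x => mem_strip_add_mul_I hy
  refine ((integrable_exp_neg_mul_abs hγ).const_mul B).mono' hc.aestronglyMeasurable ?_
  refine Filter.Eventually.of_forall fun x => ?_
  simpa using hb _ (mem_strip_add_mul_I (x := x) hy)

/-- The integral along a horizontal line of a strip does not depend on the line, for functions
which decay exponentially in the strip. -/
lemma integral_horizontal_eq {H : ℂ → ℂ} {d B γ : ℝ} (hH : DifferentiableOn ℂ H (strip d))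
    (hγ : 0 < γ) (hb : ∀ ζ ∈ strip d, ‖H ζ‖ ≤ B * Real.exp (-γ * |ζ.re|)) {y : ℝ} (hy : |y| < d) :
    ∫ x : ℝ, H x = ∫ x : ℝ, H (x + y * Complex.I) := by
  have hd : 0 < d := (abs_nonneg y).trans_lt hy
  have hint0 : MeasureTheory.Integrable fun x : ℝ => H x := by
    simpa using integrable_horizontal hH hγ hb (y := 0) (by simpa using hd)
  have hint := integrable_horizontal hH hγ hb hy
  have hseg {t : ℝ} (ht : t ∈ Set.uIcc 0 y) : |t| < d := by
    have := Set.abs_sub_left_of_mem_uIcc ht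
    simp only [sub_zero] at this
    exact this.trans_lt hy
  have hR : Filter.Tendsto (fun n : ℕ => (n : ℝ)) Filter.atTop Filter.atTop :=
    tendsto_natCast_atTop_atTop
  have hRn := Filter.tendsto_neg_atTop_atBot.comp hR
  have l0 := MeasureTheory.intervalIntegral_tendsto_integral hint0 hRn hR
  have l1 := MeasureTheory.intervalIntegral_tendsto_integral hint hRn hR
  -- the vertical sides of the rectangle
  have hside (σ : ℝ) (hσ : |σ| = 1) : Filter.Tendsto
      (fun n : ℕ => ∫ t in (0:ℝ)..y, H (((σ * n : ℝ) : ℂ) + t * Complex.I))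
      Filter.atTop (nhds 0) := by
    refine squeeze_zero_norm (a := fun n : ℕ => B * Real.exp (-γ * n) * |y - 0|) (fun n => ?_) ?_
    · refine intervalIntegral.norm_integral_le_of_norm_le_const fun t ht => ?_
      have := hb _ (mem_strip_add_mul_I (x := σ * n) (hseg (Set.uIoc_subset_uIcc ht)))
      simpa [abs_mul, hσ] using this
    · have : Filter.Tendsto (fun n : ℕ => Real.exp (-γ * n)) Filter.atTop (nhds 0) := by
        refine Real.tendsto_exp_atBot.comp ?_
        exact hR.const_mul_atTop_of_neg (by linarith)
      simpa using (this.const_mul B).mul_const |y - 0|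
  have r1 := hside 1 (by simp)
  have r2 := hside (-1) (by simp)
  have hrect (n : ℕ) : (∫ x in (-(n:ℝ))..n, H x) - (∫ x in (-(n:ℝ))..n, H (x + y * Complex.I)) +
      Complex.I • (∫ t in (0:ℝ)..y, H (((1 * n : ℝ) : ℂ) + t * Complex.I)) -
      Complex.I • (∫ t in (0:ℝ)..y, H (((-1 * n : ℝ) : ℂ) + t * Complex.I)) = 0 := by
    have := Complex.integral_boundary_rect_eq_zero_of_differentiableOn H
      (-(n : ℂ)) (n + y * Complex.I) (hH.mono ?_)
    · simpa using this
    · intro ζ hζ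
      have h2 := hζ.2
      simp only [Set.mem_preimage] at h2
      exact hseg (by simpa using h2)
  have lim := ((l0.sub l1).add (r1.const_smul Complex.I)).sub (r2.const_smul Complex.I)
  have lim0 := lim.congr (f₂ := fun _ => (0 : ℂ)) fun n => by simpa using hrect n
  have := tendsto_nhds_unique lim0 tendsto_const_nhds
  simp only [smul_zero, add_zero, sub_zero] at this
  exact sub_eq_zero.mp this

/-! ### The trapezoidal rule on the real line -/

/-- The Fourier transform of a function which is holomorphic in the strip of half-width `d`
decays like `e^{-2πd|ξ|}`: shift the line of integration towards the edge of the strip. -/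
lemma norm_integral_mul_exp_le {F : ℂ → ℂ} {G : ℝ → ℝ} {d C γ : ℝ} (hd : 0 < d)
    (hF : DifferentiableOn ℂ F (strip d)) (hγ : 0 < γ) (hFG : ∀ ζ ∈ strip d, ‖F ζ‖ ≤ G ζ.re)
    (hG : MeasureTheory.Integrable G) (hGC : ∀ x, G x ≤ C * Real.exp (-γ * |x|)) (ξ : ℝ) :
    ‖∫ x : ℝ, F x * Complex.exp (-2 * Real.pi * Complex.I * ξ * x)‖ ≤
      Real.exp (-2 * Real.pi * d * |ξ|) * ∫ x, G x := by
  have hnorm (ζ : ℂ) : ‖Complex.exp (-2 * Real.pi * Complex.I * ξ * ζ)‖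
      = Real.exp (2 * Real.pi * ξ * ζ.im) := by
    rw [Complex.norm_exp]
    simp
  have hpi := Real.pi_pos
  have hGnn (ζ : ℂ) (hζ : ζ ∈ strip d) : 0 ≤ G ζ.re := (norm_nonneg _).trans (hFG ζ hζ)
  have hC : 0 ≤ C := by
    have := (hGnn 0 (by simpa [strip] using hd)).trans (hGC _)
    simpa using this
  have hb : ∀ ζ ∈ strip d, ‖F ζ * Complex.exp (-2 * Real.pi * Complex.I * ξ * ζ)‖ ≤
      (C * Real.exp (2 * Real.pi * |ξ| * d)) * Real.exp (-γ * |ζ.re|) := by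
    intro ζ hζ
    rw [norm_mul, hnorm]
    have h1 := (hFG ζ hζ).trans (hGC _)
    have h2 : 2 * Real.pi * ξ * ζ.im ≤ 2 * Real.pi * |ξ| * d := by
      rw [mul_assoc, mul_assoc _ |ξ|]
      refine mul_le_mul_of_nonneg_left ((le_abs_self _).trans ?_) (by positivity)
      rw [abs_mul]
      exact mul_le_mul_of_nonneg_left (le_of_lt hζ) (abs_nonneg _)
    calc _ ≤ C * Real.exp (-γ * |ζ.re|) * Real.exp (2 * Real.pi * |ξ| * d) := by gcongr
      _ = _ := by ring
  have hdiff : DifferentiableOn ℂ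
      (fun ζ => F ζ * Complex.exp (-2 * Real.pi * Complex.I * ξ * ζ)) (strip d) :=
    hF.mul (by fun_prop)
  have key : ∀ s ∈ Set.Ico 0 d, ‖∫ x : ℝ, F x * Complex.exp (-2 * Real.pi * Complex.I * ξ * x)‖ ≤
      Real.exp (-2 * Real.pi * s * |ξ|) * ∫ x, G x := by
    intro s hs
    obtain ⟨y, hy, hyξ⟩ : ∃ y : ℝ, |y| = s ∧ ξ * y = -(s * |ξ|) := by
      rcases le_total 0 ξ with h | h
      · exact ⟨-s, by rw [abs_neg, abs_of_nonneg hs.1], by rw [abs_of_nonneg h]; ring⟩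
      · exact ⟨s, abs_of_nonneg hs.1, by rw [abs_of_nonpos h]; ring⟩
    have hyd : |y| < d := hy ▸ hs.2
    have h := integral_horizontal_eq hdiff hγ hb hyd
    rw [h, ← MeasureTheory.integral_const_mul]
    refine MeasureTheory.norm_integral_le_of_norm_le (hG.const_mul _)
      (Filter.Eventually.of_forall fun x => ?_)
    have h1 := hFG _ (mem_strip_add_mul_I (x := x) hyd)
    rw [norm_mul, hnorm, mul_comm]
    have e1 : ((x : ℂ) + y * Complex.I).im = y := by simp
    have e2 : ((x : ℂ) + y * Complex.I).re = x := by simp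
    rw [e2] at h1
    rw [e1, show 2 * Real.pi * ξ * y = -2 * Real.pi * s * |ξ| by
      rw [mul_assoc, hyξ]; ring]
    gcongr
  have hlim : Filter.Tendsto (fun s => Real.exp (-2 * Real.pi * s * |ξ|) * ∫ x, G x)
      (nhdsWithin d (Set.Iio d)) (nhds (Real.exp (-2 * Real.pi * d * |ξ|) * ∫ x, G x)) :=
    ((by fun_prop : Continuous fun s => Real.exp (-2 * Real.pi * s * |ξ|) * ∫ x, G x).tendsto
      d).mono_left nhdsWithin_le_nhds
  refine ge_of_tendsto hlim ?_
  filter_upwards [Ico_mem_nhdsLT hd] with s hs using key s hs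

/-- The error of the trapezoidal rule on `ℝ` for a function holomorphic in a strip. By Poisson
summation the error is the sum of the values of the Fourier transform at the nonzero multiples of
`1 / h`. -/
theorem norm_integral_sub_tsum_le {F : ℂ → ℂ} {G : ℝ → ℝ} {d C γ h : ℝ} (hd : 0 < d)
    (hF : DifferentiableOn ℂ F (strip d)) (hγ : 0 < γ) (hFG : ∀ ζ ∈ strip d, ‖F ζ‖ ≤ G ζ.re)
    (hG : MeasureTheory.Integrable G) (hGC : ∀ x, G x ≤ C * Real.exp (-γ * |x|)) (hh : 0 < h) :
    ‖(∫ x : ℝ, F x) - h * ∑' k : ℤ, F ((k * h : ℝ) : ℂ)‖ ≤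
      2 * (∫ x, G x) * (Real.exp (-(2 * Real.pi * d / h)) /
        (1 - Real.exp (-(2 * Real.pi * d / h)))) := by
  set q := Real.exp (-(2 * Real.pi * d / h)) with hq
  have hpi := Real.pi_pos
  have hq0 : 0 < q := Real.exp_pos _
  have hq1 : q < 1 := by
    rw [hq, Real.exp_lt_one_iff]
    have : 0 < 2 * Real.pi * d / h := by positivity
    linarith
  set c : ℤ → ℂ := fun m => ∫ x : ℝ, F x * Complex.exp (-2 * Real.pi * Complex.I *
    ((m / h : ℝ) : ℂ) * x) with hc
  have hcb (m : ℤ) : ‖c m‖ ≤ q ^ m.natAbs * ∫ x, G x := by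
    refine (norm_integral_mul_exp_le hd hF hγ hFG hG hGC (m / h)).trans (le_of_eq ?_)
    rw [hq, ← Real.exp_nat_mul, abs_div, abs_of_pos hh, Nat.cast_natAbs, Int.cast_abs]
    congr 2
    field_simp
  have hgeo : HasSum (fun j : ℕ => q * (∫ x, G x) * q ^ j) (q * (∫ x, G x) * (1 - q)⁻¹) :=
    (hasSum_geometric_of_lt_one hq0.le hq1).mul_left _
  obtain ⟨hsum, hbound⟩ := norm_tsum_int_sub_sum_Icc_le (f := c) 0 0 hgeo hgeo
    (fun j => by
      refine (hcb _).trans (le_of_eq ?_)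
      rw [show (((0:ℕ):ℤ) + 1 + (j:ℤ)).natAbs = j + 1 by omega]; ring)
    (fun j => by
      refine (hcb _).trans (le_of_eq ?_)
      rw [show (-(((0:ℕ):ℤ) + 1 + (j:ℤ))).natAbs = j + 1 by omega]; ring)
  have hcont : Continuous fun x : ℝ => F ((x * h : ℝ) : ℂ) :=
    hF.continuousOn.comp_continuous (by fun_prop) fun x => by simpa [strip] using hd
  have hstrip (x : ℝ) : (x : ℂ) ∈ strip d := by simpa [strip] using hd
  have hdecay : (fun x : ℝ => F ((x * h : ℝ) : ℂ)) =O[Filter.cocompact ℝ]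
      fun x : ℝ => |x| ^ (-2 : ℝ) := by
    have h1 : (fun x : ℝ => F ((x * h : ℝ) : ℂ)) =O[Filter.cocompact ℝ]
        fun x : ℝ => Real.exp (-(γ * h) * |x|) := by
      refine Asymptotics.IsBigO.of_bound C (Filter.Eventually.of_forall fun x => ?_)
      refine ((hFG _ (hstrip _)).trans (hGC _)).trans (le_of_eq ?_)
      rw [Complex.ofReal_re, abs_mul, abs_of_pos hh, Real.norm_of_nonneg (Real.exp_pos _).le]
      ring_nf
    refine h1.trans ?_
    have h2 := (isLittleO_exp_neg_mul_rpow_atTop (mul_pos hγ hh) (-2)).comp_tendsto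
      (tendsto_norm_cocompact_atTop (E := ℝ))
    exact h2.isBigO
  have hfour (m : ℤ) : FourierTransform.fourier (fun x : ℝ => F ((x * h : ℝ) : ℂ)) (m : ℝ)
      = (h : ℂ)⁻¹ * c m := by
    rw [Real.fourier_real_eq_integral_exp_smul]
    have := MeasureTheory.Measure.integral_comp_mul_right (fun t : ℝ =>
      F t * Complex.exp (-2 * Real.pi * Complex.I * ((m / h : ℝ) : ℂ) * t)) h
    rw [abs_of_pos (inv_pos.mpr hh)] at this
    rw [hc, ← Complex.ofReal_inv, ← Complex.real_smul, ← this]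
    refine MeasureTheory.integral_congr_ae (Filter.Eventually.of_forall fun x => ?_)
    have hh' : (h : ℂ) ≠ 0 := by exact_mod_cast hh.ne'
    simp only [smul_eq_mul]
    rw [mul_comm]
    congr 2
    push_cast
    field_simp
  have hpoisson := Real.tsum_eq_tsum_fourier_of_rpow_decay_of_summable hcont one_lt_two hdecay
    (by simp_rw [hfour]; exact hsum.mul_left _) 0
  have hh' : (h : ℂ) ≠ 0 := by exact_mod_cast hh.ne'
  simp only [hfour, zero_add, QuotientAddGroup.mk_zero, fourier_eval_zero, mul_one,
    tsum_mul_left] at hpoisson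
  have hc0 : c 0 = ∫ x : ℝ, F x := by simp [hc]
  rw [hpoisson, mul_inv_cancel_left₀ hh', ← hc0, norm_sub_rev]
  simp only [Nat.cast_zero, neg_zero, Finset.Icc_self, Finset.sum_singleton] at hbound
  refine hbound.trans (le_of_eq ?_)
  ring

/-! ### Majorants of the transformed integrand -/

/-- The integrand `f (φ(ζ)) φ'(ζ)` after the substitution `x = φ(ζ)`. -/
noncomputable def transformed (f : ℂ → ℂ) (ζ : ℂ) : ℂ := f (phi ζ) * deriv phi ζ

/-- The factor of `C₃` which bounds `φ'(ζ) / (1 + e^{-ζ})` in the left half of the strip. -/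
noncomputable def leftDerivConst (c : ℝ) : ℝ :=
  (1 + Real.log (2 + c) ^ 2) / Real.log (2 + c) ^ 2 * (1 + c) ^ 2

/-- The constant of the exponential majorant in the right half of the strip. -/
noncomputable def rightConst (β c : ℝ) : ℝ :=
  (1 + lambdaConst ^ 2) * c * (Real.exp lambdaConst * c) ^ β

/-- A majorant of the transformed integrand on every line of the strip, in terms of `Re ζ`. -/
noncomputable def majorant (K α β c x : ℝ) : ℝ :=
  if x < 0 then K * (leftConst c ^ (α + 1) * leftDerivConst c *
    (Real.exp ((α + 1) * x) + Real.exp (α * x)))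
  else K * (rightConst β c * Real.exp (-β * x))

lemma rightConst_nonneg {β c : ℝ} (hc : 0 ≤ c) : 0 ≤ rightConst β c := by
  unfold rightConst; positivity

lemma leftDerivConst_nonneg {c : ℝ} : 0 ≤ leftDerivConst c := by
  unfold leftDerivConst; positivity

lemma exp_one_sub_one_pos : 0 < Real.exp 1 - 1 := by
  linarith [Real.add_one_lt_exp one_ne_zero]

lemma leftConst_nonneg {c : ℝ} (hc : 0 ≤ c) : 0 ≤ leftConst c := by
  have := one_sub_log_two_pos
  have := exp_one_sub_one_pos
  unfold leftConst; positivity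

lemma norm_transformed_le_right {f : ℂ → ℂ} {K β c : ℝ} (hK : 0 < K) (hβ : 0 < β) {ζ : ℂ}
    (hζ : |ζ.im| < Real.pi) (hre : 0 ≤ ζ.re) (hc : 1 ≤ c * Real.cos (ζ.im / 2)) (hc0 : 0 ≤ c)
    (hf : ‖f (phi ζ)‖ ≤ K * ‖Complex.exp (-phi ζ)‖ ^ β) :
    ‖transformed f ζ‖ ≤ K * (rightConst β c * Real.exp (-β * ζ.re)) := by
  have h1 := norm_exp_neg_phi_le hζ hre hc hc0
  have h2 := norm_deriv_phi_le_right hζ hre hc hc0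
  rw [transformed, norm_mul]
  calc ‖f (phi ζ)‖ * ‖deriv phi ζ‖
      ≤ (K * (Real.exp lambdaConst * c * Real.exp (-ζ.re)) ^ β) *
        ((1 + lambdaConst ^ 2) * c) := by
        refine mul_le_mul (hf.trans ?_) h2 (norm_nonneg _) (by positivity)
        gcongr
    _ = _ := by
      rw [Real.mul_rpow (by positivity) (Real.exp_pos _).le, ← Real.exp_mul, rightConst,
        show -ζ.re * β = -β * ζ.re by ring]
      ring

lemma norm_transformed_le_left {f : ℂ → ℂ} {K α c : ℝ} (hK : 0 < K) (hα : 0 < α) {ζ : ℂ}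
    (hζ : |ζ.im| < Real.pi) (hre : ζ.re < 0) (hc : 1 ≤ c * Real.cos (ζ.im / 2)) (hc0 : 0 ≤ c)
    (hf : ‖f (phi ζ)‖ ≤ K * (1 / ‖phi ζ‖ ^ (α + 1))) :
    ‖transformed f ζ‖ ≤ K * (leftConst c ^ (α + 1) * leftDerivConst c *
      (Real.exp ((α + 1) * ζ.re) + Real.exp (α * ζ.re))) := by
  have h1 := norm_inv_phi_le hζ hre hc hc0
  have h2 := norm_deriv_phi_le_left hζ hc hc0
  rw [one_div, ← Real.inv_rpow (norm_nonneg _)] at hf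
  have hA := leftConst_nonneg hc0
  rw [transformed, norm_mul]
  calc ‖f (phi ζ)‖ * ‖deriv phi ζ‖
      ≤ (K * (leftConst c * Real.exp ζ.re) ^ (α + 1)) *
        ((1 + Real.exp (-ζ.re)) * leftDerivConst c) := by
        refine mul_le_mul (hf.trans ?_) h2 (norm_nonneg _) (by positivity)
        gcongr
    _ = _ := by
      rw [Real.mul_rpow hA (Real.exp_pos _).le, ← Real.exp_mul,
        show Real.exp (α * ζ.re) = Real.exp ((α + 1) * ζ.re) * Real.exp (-ζ.re) by
          rw [← Real.exp_add]; ring_nf, mul_comm ζ.re]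
      ring

lemma cConst_spec {d : ℝ} (hdπ : d < Real.pi) {y : ℝ} (hy : |y| < d) :
    1 ≤ cConst d * Real.cos (y / 2) ∧ 0 ≤ cConst d := by
  have hy0 := abs_nonneg y
  have hd : 0 < Real.cos (d / 2) := Real.cos_pos_of_mem_Ioo ⟨by linarith, by linarith⟩
  have h : Real.cos (d / 2) ≤ Real.cos (y / 2) := by
    rw [← Real.cos_abs (y / 2)]
    have : |y / 2| = |y| / 2 := by rw [abs_div, abs_two]
    refine Real.cos_le_cos_of_nonneg_of_le_pi (abs_nonneg _) (by linarith) (by rw [this]; linarith)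
  unfold cConst
  refine ⟨?_, by positivity⟩
  rwa [one_div_mul_eq_div, le_div_iff₀ hd, one_mul]

lemma integral_majorant {K α β d : ℝ} (hα : 0 < α) (hβ : 0 < β) :
    MeasureTheory.Integrable (majorant K α β (cConst d)) ∧
      ∫ x, majorant K α β (cConst d) x = K * C₃ α β d := by
  have hα1 : 0 < α + 1 := by linarith
  have i1 := integrableOn_exp_mul_Iic hα1 0
  have i2 := integrableOn_exp_mul_Iic hα 0
  have i3 := integrableOn_exp_mul_Ioi (neg_lt_zero.mpr hβ) 0
  obtain ⟨h1, h2⟩ := integrable_ite_neg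
    (((i1.add i2).const_mul (leftConst (cConst d) ^ (α + 1) * leftDerivConst (cConst d))).const_mul K)
    ((i3.const_mul (rightConst β (cConst d))).const_mul K)
  refine ⟨h1, h2.trans ?_⟩
  simp only [Pi.add_apply]
  rw [MeasureTheory.integral_const_mul, MeasureTheory.integral_const_mul,
    MeasureTheory.integral_const_mul, MeasureTheory.integral_const_mul,
    MeasureTheory.integral_add i1 i2, integral_exp_mul_Iic hα1, integral_exp_mul_Iic hα,
    integral_exp_mul_Ioi (neg_lt_zero.mpr hβ)]
  simp only [mul_zero, Real.exp_zero, neg_div_neg_eq]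
  unfold C₃ leftConst leftDerivConst rightConst
  ring

lemma majorant_le {K α β c : ℝ} (hK : 0 < K) (hc : 0 ≤ c) (x : ℝ) :
    majorant K α β c x ≤
      K * (leftConst c ^ (α + 1) * leftDerivConst c * 2 + rightConst β c) *
        Real.exp (-(min α β) * |x|) := by
  have hA := leftConst_nonneg hc
  have hB := leftDerivConst_nonneg (c := c)
  have hR := rightConst_nonneg (β := β) hc
  unfold majorant
  split_ifs with hx
  · have h1 : Real.exp ((α + 1) * x) ≤ Real.exp (-(min α β) * |x|) := by
      rw [Real.exp_le_exp, abs_of_neg hx]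
      nlinarith [min_le_left α β]
    have h2 : Real.exp (α * x) ≤ Real.exp (-(min α β) * |x|) := by
      rw [Real.exp_le_exp, abs_of_neg hx]
      nlinarith [min_le_left α β]
    set X := Real.exp (-(min α β) * |x|)
    have hX : 0 ≤ X := (Real.exp_pos _).le
    rw [mul_assoc K]
    refine mul_le_mul_of_nonneg_left ?_ hK.le
    have : leftConst c ^ (α + 1) * leftDerivConst c *
      (Real.exp ((α + 1) * x) + Real.exp (α * x)) ≤
        leftConst c ^ (α + 1) * leftDerivConst c * (X + X) := by gcongr
    nlinarith [mul_nonneg hR hX]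
  · have h1 : Real.exp (-β * x) ≤ Real.exp (-(min α β) * |x|) := by
      rw [Real.exp_le_exp, abs_of_nonneg (not_lt.mp hx)]
      nlinarith [min_le_right α β]
    rw [mul_assoc]
    gcongr
    have : 0 ≤ leftConst c ^ (α + 1) * leftDerivConst c * 2 := by positivity
    linarith

/-! ### The map `phi` on the real line -/

lemma logOneAddExp_ofReal (x : ℝ) :
    logOneAddExp (x : ℂ) = ((Real.log (1 + Real.exp x) : ℝ) : ℂ) := by
  rw [logOneAddExp, Complex.ofReal_log (by positivity)]
  push_cast
  rfl

lemma abs_im_ofReal_lt_pi (x : ℝ) : |(x : ℂ).im| < Real.pi := by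
  simpa using Real.pi_pos

/-- The restriction of `phi` to the real line, as a real function. -/
noncomputable def realPhi (x : ℝ) : ℝ :=
  Real.log (1 + Real.exp x) - (Real.log (1 + Real.exp x))⁻¹

/-- The derivative of `realPhi`. -/
noncomputable def realPhiDeriv (x : ℝ) : ℝ :=
  Real.exp x / (1 + Real.exp x) * (1 + ((Real.log (1 + Real.exp x))⁻¹) ^ 2)

lemma phi_ofReal (x : ℝ) : phi (x : ℂ) = (realPhi x : ℂ) := by
  rw [phi_eq (abs_im_ofReal_lt_pi x), logOneAddExp_ofReal, realPhi]
  push_cast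
  rfl

lemma hasDerivAt_phi_ofReal (x : ℝ) : HasDerivAt phi (realPhiDeriv x : ℂ) (x : ℂ) := by
  refine (hasDerivAt_phi (abs_im_ofReal_lt_pi x)).congr_deriv ?_
  rw [logOneAddExp_ofReal, realPhiDeriv]
  push_cast
  rfl

lemma hasDerivAt_realPhi (x : ℝ) : HasDerivAt realPhi (realPhiDeriv x) x := by
  have h := (hasDerivAt_phi_ofReal x).real_of_complex
  simpa [phi_ofReal] using h

lemma log_one_add_exp_pos (x : ℝ) : 0 < Real.log (1 + Real.exp x) :=
  Real.log_pos (by linarith [Real.exp_pos x])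

lemma realPhiDeriv_pos (x : ℝ) : 0 < realPhiDeriv x := by
  unfold realPhiDeriv; positivity

lemma realPhi_injective : Function.Injective realPhi :=
  (strictMono_of_deriv_pos fun x => by
    rw [(hasDerivAt_realPhi x).deriv]; exact realPhiDeriv_pos x).injective

lemma realPhi_surjective : Function.Surjective realPhi := by
  intro t
  -- the positive root of `l ^ 2 - t l - 1 = 0`
  set l := (t + Real.sqrt (t ^ 2 + 4)) / 2 with hl
  have hs := Real.sq_sqrt (show 0 ≤ t ^ 2 + 4 by positivity)
  have hs0 := Real.sqrt_nonneg (t ^ 2 + 4)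
  have hl0 : 0 < l := by
    have : |t| < Real.sqrt (t ^ 2 + 4) := by
      rw [← Real.sqrt_sq_eq_abs]
      exact Real.sqrt_lt_sqrt (sq_nonneg _) (by linarith)
    have := neg_abs_le t
    rw [hl]; linarith
  have hroot : l - l⁻¹ = t := by
    have : l * l = t * l + 1 := by rw [hl]; nlinarith
    field_simp
    linarith
  have he : 0 < Real.exp l - 1 := by linarith [Real.add_one_lt_exp hl0.ne']
  refine ⟨Real.log (Real.exp l - 1), ?_⟩
  rw [realPhi, Real.exp_log he, add_sub_cancel, Real.log_exp, hroot]

lemma transformed_ofReal (f : ℂ → ℂ) (x : ℝ) :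
    transformed f x = |realPhiDeriv x| • f (realPhi x : ℂ) := by
  rw [transformed, phi_ofReal, (hasDerivAt_phi_ofReal x).deriv, abs_of_pos (realPhiDeriv_pos x),
    Complex.real_smul, mul_comm]

lemma integral_transformed (f : ℂ → ℂ) :
    ∫ x : ℝ, transformed f x = ∫ x : ℝ, f x := by
  have h := MeasureTheory.integral_image_eq_integral_abs_deriv_smul MeasurableSet.univ
    (fun x _ => (hasDerivAt_realPhi x).hasDerivWithinAt) realPhi_injective.injOn
    (fun x : ℝ => f (x : ℂ))
  rw [Set.image_univ, realPhi_surjective.range_eq, MeasureTheory.setIntegral_univ,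
    MeasureTheory.setIntegral_univ] at h
  simp_rw [transformed_ofReal]
  exact h.symm

lemma integrable_of_integrable_transformed {f : ℂ → ℂ}
    (hf : MeasureTheory.Integrable fun x : ℝ => transformed f x) :
    MeasureTheory.Integrable fun x : ℝ => f x := by
  have h := MeasureTheory.integrableOn_image_iff_integrableOn_abs_deriv_smul MeasurableSet.univ
    (fun x _ => (hasDerivAt_realPhi x).hasDerivWithinAt) realPhi_injective.injOn
    (fun x : ℝ => f (x : ℂ))
  rw [Set.image_univ, realPhi_surjective.range_eq, MeasureTheory.integrableOn_univ,
    MeasureTheory.integrableOn_univ] at h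
  simp_rw [transformed_ofReal] at hf
  exact h.mpr hf

/-- On the negative real axis the majorant can be improved to a single exponential: with
`l = log (1 + e^x) < log 2` and `φ = -(1 - l) (1 + l) / l`, the bound follows from `l ≤ e^x`,
`e^x / (1 + e^x) ≤ l` and `l² ≤ l`. -/
lemma norm_transformed_le_of_neg {f : ℂ → ℂ} {K α : ℝ} (hK : 0 < K) (hα : 0 < α) {x : ℝ}
    (hx : x < 0) (hf : ‖f (phi x)‖ ≤ K * (1 / ‖phi x‖ ^ (α + 1))) :
    ‖transformed f x‖ ≤ K * (1 / (1 - Real.log 2) ^ (α + 1)) * Real.exp (α * x) := by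
  have hl0 := log_one_add_exp_pos x
  have hE := Real.exp_pos x
  have h12 := one_sub_log_two_pos
  have hl2 : Real.log (1 + Real.exp x) ≤ Real.log 2 :=
    Real.log_le_log (by linarith) (by linarith [Real.exp_lt_one_iff.mpr hx])
  have hlE : Real.log (1 + Real.exp x) ≤ Real.exp x := by
    linarith [Real.log_le_sub_one_of_pos (show 0 < 1 + Real.exp x by linarith)]
  have hEl : Real.exp x / (1 + Real.exp x) ≤ Real.log (1 + Real.exp x) := by
    have := Real.one_sub_inv_le_log_of_pos (show 0 < 1 + Real.exp x by linarith)
    refine le_trans (le_of_eq ?_) this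
    field_simp
    ring
  have hnd : ‖deriv phi (x : ℂ)‖ = realPhiDeriv x := by
    rw [(hasDerivAt_phi_ofReal x).deriv, Complex.norm_real,
      Real.norm_of_nonneg (realPhiDeriv_pos x).le]
  have hnp : ‖phi (x : ℂ)‖ = |realPhi x| := by
    rw [phi_ofReal, Complex.norm_real, Real.norm_eq_abs]
  unfold realPhiDeriv at hnd
  unfold realPhi at hnp
  set l := Real.log (1 + Real.exp x)
  have hphi : ‖phi (x : ℂ)‖⁻¹ ≤ l / (1 + l) * (1 - Real.log 2)⁻¹ := by
    have e1 : l - l⁻¹ = -((1 - l) * (1 + l) / l) := by field_simp; ring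
    have h1l : 0 < 1 - l := by linarith
    rw [hnp, e1, abs_neg, abs_of_nonneg (by positivity), inv_div, mul_comm (1 - l), ← div_div,
      div_eq_mul_inv _ (1 - l)]
    gcongr
  rw [one_div, ← Real.inv_rpow (norm_nonneg _)] at hf
  have hd : ‖deriv phi (x : ℂ)‖ ≤ l * (1 + l⁻¹ ^ 2) := by
    rw [hnd]; gcongr
  have hq : l / (1 + l) ≤ Real.exp x := by
    rw [div_le_iff₀ (by linarith)]
    nlinarith
  have hfin : l / (1 + l) * (l * (1 + l⁻¹ ^ 2)) ≤ 1 := by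
    have : l / (1 + l) * (l * (1 + l⁻¹ ^ 2)) = (1 + l ^ 2) / (1 + l) := by field_simp; ring
    rw [this, div_le_one (by linarith)]
    nlinarith
  rw [transformed, norm_mul]
  calc ‖f (phi x)‖ * ‖deriv phi (x : ℂ)‖
      ≤ (K * (l / (1 + l) * (1 - Real.log 2)⁻¹) ^ (α + 1)) * (l * (1 + l⁻¹ ^ 2)) := by
        refine mul_le_mul (hf.trans ?_) hd (norm_nonneg _) (by positivity)
        gcongr
    _ = K * (1 / (1 - Real.log 2) ^ (α + 1)) * ((l / (1 + l)) ^ α *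
          (l / (1 + l) * (l * (1 + l⁻¹ ^ 2)))) := by
      rw [Real.mul_rpow (by positivity) (by positivity), Real.inv_rpow h12.le,
        Real.rpow_add_one (by positivity : l / (1 + l) ≠ 0)]
      ring
    _ ≤ K * (1 / (1 - Real.log 2) ^ (α + 1)) * (Real.exp x ^ α * 1) := by gcongr
    _ = _ := by rw [mul_one, ← Real.exp_mul, mul_comm x]

/-! ### Truncation of the sum -/

/-- A lower Riemann sum of a decaying exponential is at most the integral. -/
lemma hasSum_exp_tail {D γ h : ℝ} (hD : 0 ≤ D) (hγ : 0 < γ) (hh : 0 < h) (N : ℕ) :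
    ∃ S, HasSum (fun j : ℕ => D * Real.exp (-γ * ((N + 1 + j) * h))) S ∧
      h * S ≤ D / γ * Real.exp (-(γ * N * h)) := by
  set q := Real.exp (-(γ * h)) with hq
  have hpos : 0 < γ * h := mul_pos hγ hh
  have hq0 : 0 < q := Real.exp_pos _
  have hq1 : q < 1 := Real.exp_lt_one_iff.mpr (by linarith)
  refine ⟨D * Real.exp (-(γ * N * h)) * q * (1 - q)⁻¹, ?_, ?_⟩
  · have := (hasSum_geometric_of_lt_one hq0.le hq1).mul_left (D * Real.exp (-(γ * N * h)) * q)
    have hterm : (fun j : ℕ => D * Real.exp (-γ * ((N + 1 + j) * h))) =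
        fun j : ℕ => D * Real.exp (-(γ * N * h)) * q * q ^ j := by
      funext j
      rw [mul_assoc, mul_assoc, hq, ← Real.exp_nat_mul, ← Real.exp_add, ← Real.exp_add]
      congr 2
      ring
    rwa [hterm]
  · have h1 : γ * h * q ≤ 1 - q := by
      have h2 := Real.add_one_le_exp (γ * h)
      have h3 : Real.exp (γ * h) * q = 1 := by rw [hq, ← Real.exp_add]; simp
      nlinarith
    have h4 : h * (q * (1 - q)⁻¹) ≤ 1 / γ := by
      rw [← div_eq_mul_inv, ← mul_div_assoc, div_le_div_iff₀ (by linarith) hγ]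
      nlinarith
    calc _ = D * Real.exp (-(γ * N * h)) * (h * (q * (1 - q)⁻¹)) := by ring
      _ ≤ D * Real.exp (-(γ * N * h)) * (1 / γ) := by gcongr
      _ = _ := by ring

lemma min_mul_le_truncM {α β : ℝ} (hα : 0 < α) (n : ℕ) :
    min α β * n ≤ α * truncM α β n := by
  unfold truncM
  split_ifs with h
  · rw [min_eq_left h]
  · rw [min_eq_right (not_le.mp h).le]
    have := Nat.le_ceil (β * n / α)
    rwa [div_le_iff₀' hα] at this

lemma min_mul_le_truncN {α β : ℝ} (hβ : 0 < β) (n : ℕ) :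
    min α β * n ≤ β * truncN α β n := by
  unfold truncN
  split_ifs with h
  · rw [min_eq_left h]
    have := Nat.le_ceil (α * n / β)
    rwa [div_le_iff₀' hβ] at this
  · rw [min_eq_right (not_le.mp h).le]

/-- The step is chosen so that the discretization and the truncation exponents agree. -/
lemma meshSize_spec {d μ : ℝ} (hd : 0 < d) (hμ : 0 < μ) {n : ℕ} (hn : 0 < n) :
    0 < meshSize d μ n ∧ 2 * Real.pi * d / meshSize d μ n = Real.sqrt (2 * Real.pi * d * μ * n) ∧
      μ * n * meshSize d μ n = Real.sqrt (2 * Real.pi * d * μ * n) := by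
  have hpi := Real.pi_pos
  have hn' : (0 : ℝ) < n := by exact_mod_cast hn
  have h0 : 0 < meshSize d μ n := Real.sqrt_pos.mpr (by positivity)
  have hsq : meshSize d μ n ^ 2 = 2 * Real.pi * d / (μ * n) := Real.sq_sqrt (by positivity)
  set h := meshSize d μ n
  have hsq' : h ^ 2 * (μ * n) = 2 * Real.pi * d := by rw [hsq]; field_simp
  have key : μ * n * h = Real.sqrt (2 * Real.pi * d * μ * n) := by
    symm
    rw [Real.sqrt_eq_iff_mul_self_eq (by positivity) (by positivity), ← hsq']
    ring
  refine ⟨h0, ?_, key⟩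
  rw [← key, div_eq_iff h0.ne', ← hsq']
  ring

end SincQuadrature

open SincQuadrature

theorem theorem3 (f : ℂ → ℂ) (d K α β : ℝ)
    (hd₀ : 0 < d) (hdπ : d < Real.pi) (hK : 0 < K) (hα : 0 < α) (hβ : 0 < β)
    (hf : AnalyticOnNhd ℂ f (SincQuadrature.phi '' SincQuadrature.strip d))
    (hpos : ∀ z ∈ SincQuadrature.phi '' SincQuadrature.stripPos d,
      ‖f z‖ ≤ K * ‖Complex.exp (-z)‖ ^ β)
    (hneg : ∀ z ∈ SincQuadrature.phi '' SincQuadrature.stripNeg d,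
      ‖f z‖ ≤ K * (1 / ‖z‖ ^ (α + 1)))
    (n : ℕ) (hn : 0 < n) :
    MeasureTheory.Integrable (fun x : ℝ => f (x : ℂ)) ∧
    ‖(∫ x : ℝ, f (x : ℂ)) -
        SincQuadrature.trapezoid f (SincQuadrature.meshSize d (min α β) n)
          (SincQuadrature.truncM α β n) (SincQuadrature.truncN α β n)‖ ≤
      K * (2 * SincQuadrature.C₃ α β d
            / (1 - Real.exp (-Real.sqrt (2 * Real.pi * d * min α β)))
          + SincQuadrature.C₄ α β)
        * Real.exp (-Real.sqrt (2 * Real.pi * d * min α β * n)) := by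
  have hpi := Real.pi_pos
  have hstrip {ζ : ℂ} (hζ : ζ ∈ strip d) : |ζ.im| < Real.pi := lt_trans hζ hdπ
  have hμ : 0 < min α β := lt_min hα hβ
  have hF : DifferentiableOn ℂ (transformed f) (strip d) := by
    intro ζ hζ
    have hphi : AnalyticOnNhd ℂ phi (strip d) :=
      DifferentiableOn.analyticOnNhd (fun w hw =>
        (hasDerivAt_phi (hstrip hw)).differentiableAt.differentiableWithinAt) (isOpen_strip d)
    exact (((hf _ ⟨ζ, hζ, rfl⟩).comp (hphi ζ hζ)).mul
      (hphi ζ hζ).deriv).differentiableAt.differentiableWithinAt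
  have hFG : ∀ ζ ∈ strip d, ‖transformed f ζ‖ ≤ majorant K α β (cConst d) ζ.re := by
    intro ζ hζ
    obtain ⟨hc, hc0⟩ := cConst_spec hdπ hζ
    unfold majorant
    split_ifs with hre
    · exact norm_transformed_le_left hK hα (hstrip hζ) hre hc hc0 (hneg _ ⟨ζ, ⟨hζ, hre⟩, rfl⟩)
    · exact norm_transformed_le_right hK hβ (hstrip hζ) (not_lt.mp hre) hc hc0
        (hpos _ ⟨ζ, ⟨hζ, not_lt.mp hre⟩, rfl⟩)
  have hmem (x : ℝ) : (x : ℂ) ∈ strip d := by simpa [strip] using hd₀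
  have hc0 := (cConst_spec hdπ (hmem 0)).2
  obtain ⟨hGint, hGval⟩ := integral_majorant (K := K) (d := d) hα hβ
  have hGC := majorant_le (α := α) (β := β) hK hc0
  have hFint : MeasureTheory.Integrable fun x : ℝ => transformed f x := by
    have := integrable_horizontal hF hμ (fun ζ hζ => (hFG ζ hζ).trans (hGC _)) (y := 0)
      (by simpa using hd₀)
    simpa using this
  refine ⟨integrable_of_integrable_transformed hFint, ?_⟩
  obtain ⟨hh, hdisc, htrunc⟩ := meshSize_spec hd₀ hμ hn
  have hquad := norm_integral_sub_tsum_le hd₀ hF hμ hFG hGint hGC hh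
  rw [integral_transformed, hGval, hdisc] at hquad
  set h := meshSize d (min α β) n
  set M := truncM α β n
  set N := truncN α β n
  set E := Real.sqrt (2 * Real.pi * d * min α β * n)
  have h12 := one_sub_log_two_pos
  -- on the real line `c = 1` is allowed, so the tails do not involve `d`
  obtain ⟨A, hA, hAle⟩ := hasSum_exp_tail (D := K * rightConst β 1) (γ := β)
    (mul_nonneg hK.le (rightConst_nonneg zero_le_one)) hβ hh N
  obtain ⟨B, hB, hBle⟩ := hasSum_exp_tail (D := K * (1 / (1 - Real.log 2) ^ (α + 1))) (γ := α)
    (by positivity) hα hh M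
  have htail := (norm_tsum_int_sub_sum_Icc_le
    (f := fun k : ℤ => transformed f ((k * h : ℝ) : ℂ)) M N hA hB
    (fun j => by
      have hx : (0 : ℝ) ≤ ((N + 1 + j : ℤ) : ℝ) * h := by push_cast; positivity
      have := norm_transformed_le_right (c := 1)
        (ζ := ((((N + 1 + j : ℤ) : ℝ) * h : ℝ) : ℂ)) hK hβ (abs_im_ofReal_lt_pi _)
        (by rwa [Complex.ofReal_re]) (by simp) zero_le_one
        (hpos _ ⟨_, ⟨hmem _, by rwa [Complex.ofReal_re]⟩, rfl⟩)
      refine this.trans (le_of_eq ?_)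
      rw [Complex.ofReal_re, mul_assoc]
      push_cast
      rfl)
    (fun j => by
      have hx : ((-(M + 1 + j) : ℤ) : ℝ) * h < 0 := by
        have : 0 < ((M : ℝ) + 1 + j) * h := by positivity
        push_cast
        linarith
      have := norm_transformed_le_of_neg hK hα hx
        (hneg _ ⟨_, ⟨hmem _, by rwa [Complex.ofReal_re]⟩, rfl⟩)
      refine this.trans (le_of_eq ?_)
      congr 2
      push_cast
      ring)).2
  have htrap : trapezoid f h M N =
      h * ∑ k ∈ Finset.Icc (-(M : ℤ)) (N : ℤ), transformed f ((k * h : ℝ) : ℂ) := rfl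
  set S := ∑ k ∈ Finset.Icc (-(M : ℤ)) (N : ℤ), transformed f ((k * h : ℝ) : ℂ)
  set T := ∑' k : ℤ, transformed f ((k * h : ℝ) : ℂ)
  have hsplit : (∫ x : ℝ, f x) - trapezoid f h M N
      = ((∫ x : ℝ, f x) - h * T) + h * (T - S) := by rw [htrap]; ring
  have hNE : Real.exp (-(β * N * h)) ≤ Real.exp (-E) := by
    rw [Real.exp_le_exp, ← htrunc]
    have := mul_le_mul_of_nonneg_right (min_mul_le_truncN (α := α) hβ n) hh.le
    linarith
  have hME : Real.exp (-(α * M * h)) ≤ Real.exp (-E) := by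
    rw [Real.exp_le_exp, ← htrunc]
    have := mul_le_mul_of_nonneg_right (min_mul_le_truncM (β := β) hα n) hh.le
    linarith
  have hE0 : 0 < Real.sqrt (2 * Real.pi * d * min α β) := Real.sqrt_pos.mpr (by positivity)
  have hEle : Real.sqrt (2 * Real.pi * d * min α β) ≤ E := by
    refine Real.sqrt_le_sqrt (le_mul_of_one_le_right (by positivity) ?_)
    exact_mod_cast hn
  have hden : 0 < 1 - Real.exp (-Real.sqrt (2 * Real.pi * d * min α β)) := by
    have := Real.exp_lt_one_iff.mpr (neg_lt_zero.mpr hE0)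
    linarith
  have hKC : 0 ≤ K * C₃ α β d := by
    rw [← hGval]
    exact MeasureTheory.integral_nonneg fun x =>
      (norm_nonneg _).trans (by simpa using hFG _ (hmem x))
  have hpart1 : 2 * (K * C₃ α β d) * (Real.exp (-E) / (1 - Real.exp (-E))) ≤
      2 * (K * C₃ α β d) * (Real.exp (-E) /
        (1 - Real.exp (-Real.sqrt (2 * Real.pi * d * min α β)))) := by
    gcongr
  have hpart2 : h * (A + B) ≤ K * C₄ α β * Real.exp (-E) := by
    have hexp : 1 ≤ Real.exp (1 / Real.pi ^ 3) := Real.one_le_exp (by positivity)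
    have hr := rightConst_nonneg (β := β) (c := 1) zero_le_one
    calc h * (A + B) ≤ K * rightConst β 1 / β * Real.exp (-E) +
          K * (1 / (1 - Real.log 2) ^ (α + 1)) / α * Real.exp (-E) := by
          rw [mul_add]
          refine add_le_add (hAle.trans ?_) (hBle.trans ?_) <;> gcongr
      _ = K * (1 / (α * (1 - Real.log 2) ^ (α + 1)) +
            (1 + lambdaConst ^ 2) / β * (Real.exp lambdaConst) ^ β) * Real.exp (-E) := by
          unfold rightConst
          field_simp
          ring
      _ ≤ _ := by
          unfold C₄
          gcongr
  rw [hsplit]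
  refine (norm_add_le _ _).trans ?_
  rw [norm_mul, Complex.norm_real, Real.norm_of_nonneg hh.le]
  calc _ ≤ 2 * (K * C₃ α β d) * (Real.exp (-E) /
        (1 - Real.exp (-Real.sqrt (2 * Real.pi * d * min α β)))) + h * (A + B) := by
        gcongr
        exact hquad.trans hpart1
    _ ≤ 2 * (K * C₃ α β d) * (Real.exp (-E) /
        (1 - Real.exp (-Real.sqrt (2 * Real.pi * d * min α β)))) +
          K * C₄ α β * Real.exp (-E) := by gcongr
    _ = _ := by ring
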